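/- For a polytope $P\subseteq\mathbb R^n$, an extended formulation of $P$ consists of a polyhedron $Q=\{z\in\mathbb R^m : Cz\le c,\ Dz=d\}$ and a linear map $p:\mathbb R^m\to\mathbb R^n$ with $p(Q)=P$; its size is the number of inequalities (the number of rows of $C$; equations are not counted). The extension complexity $\operatorname{xc}(P)$ is the smallest size of an extended formulation of $P$. Theorem. There is an absolute constant $c>0$ such that for every integer $n\ge 1$ there exists a set $X\subseteq\{0,1\}^n$ with $$\operatorname{xc}(\operatorname{conv}(X))\ \ge\ c\cdot\frac{2^{n/2}}{\sqrt{n\log_2(2n)}}.$$ -/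

import Mathlib

/-- An extended formulation, with `k` inequalities, of a set `P ⊆ ℝⁿ`: a polyhedron
`Q = {z ∈ ℝᵐ | C z ≤ c, D z = d}`, where `C` has `k` rows (and `D` any finite number of rows),
together with a linear map `p : ℝᵐ → ℝⁿ` such that `p(Q) = P`. -/
structure ExtendedFormulation {n : ℕ} (P : Set (Fin n → ℝ)) (k : ℕ) where
  /-- dimension of the ambient space of `Q` -/
  m : ℕ
  /-- number of equations -/
  e : ℕ
  C : Matrix (Fin k) (Fin m) ℝ
  c : Fin k → ℝ
  D : Matrix (Fin e) (Fin m) ℝ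
  d : Fin e → ℝ
  p : (Fin m → ℝ) →ₗ[ℝ] (Fin n → ℝ)
  image_eq : p '' {z | (∀ i, C.mulVec z i ≤ c i) ∧ D.mulVec z = d} = P

/-- The extension complexity `xc(P)`: the smallest size (number of inequalities; equations are
not counted) of an extended formulation of `P`. For a polytope the set below is nonempty. -/
noncomputable def extensionComplexity {n : ℕ} (P : Set (Fin n → ℝ)) : ℕ :=
  sInf {k : ℕ | Nonempty (ExtendedFormulation P k)}

/-! A counting argument: there are `2 ^ 2 ^ n` sets `A` of cube vertices, and a formulation of size
`r` lets `A` be encoded by an integer matrix of order `n + r + 1` with entries of `O(n)` bits, so `2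
^ n ≤ 9 * n * (n + r + 1) ^ 2`. For the encoding, attach to each vertex `x` a normalised slack
vector `y` and let `W` be the span of the vectors `(x, y, 1)`. The matrix is the orthogonal
projection onto the complement of `W`, scaled by `K` and rounded (`exists_integer_matrix`). Decoding
accepts `u` if some `s` in the unit cube makes `(u, s, 1)` nearly a kernel vector. Such a vector is
close to `W`, and a small change of weights yields a point of the polytope near `u`
(`mem_of_close`). A vertex outside `A` is too far away for that (`one_le_sum_abs_sub`). -/

namespace ExtendedFormulation

/-- The vertex of the cube `[0, 1]ⁿ` with a given support. -/
def cubePoint {n : ℕ} (v : Fin n → Bool) : Fin n → ℝ := fun i => if v i then 1 else 0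

/-- The vector `(x, y, 1)`. -/
def homogenize {n r : ℕ} (x : Fin n → ℝ) (y : Fin r → ℝ) : Fin n ⊕ (Fin r ⊕ Unit) → ℝ :=
  Sum.elim x (Sum.elim y fun _ => 1)

/-! ### Extended formulations and slack vectors -/

/-- The number of inequalities can be increased by adding trivial ones. -/
theorem nonempty_mono {n k r : ℕ} {P : Set (Fin n → ℝ)} (h : k ≤ r)
    (E : ExtendedFormulation P k) : Nonempty (ExtendedFormulation P r) := by
  refine ⟨⟨E.m, E.e, Matrix.of fun i => if h : i.1 < k then E.C ⟨i, h⟩ else 0,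
    fun i => if h : i.1 < k then E.c ⟨i, h⟩ else 0, E.D, E.d, E.p, ?_⟩⟩
  refine Eq.trans ?_ E.image_eq
  congr 1
  ext z
  simp only [Set.mem_ofPred_eq]
  refine and_congr_left fun _ => ⟨fun H i => ?_, fun H i => ?_⟩
  · have := H ⟨i, i.2.trans_le h⟩
    simpa [Matrix.mulVec] using this
  · by_cases hi : i.1 < k
    · simpa [Matrix.mulVec, hi] using H ⟨i, hi⟩
    · simp [Matrix.mulVec, hi]

/-- A polytope is a projection of a simplex. -/
theorem nonempty_of_finite {n : ℕ} {X : Set (Fin n → ℝ)} (hX : X.Finite) :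
    ∃ k, Nonempty (ExtendedFormulation (convexHull ℝ X) k) := by
  classical
  obtain ⟨k, f, -, rfl⟩ := hX.fin_param
  refine ⟨k, ⟨⟨k, 1, -1, 0, fun _ _ => 1, 1, Fintype.linearCombination ℝ f, ?_⟩⟩⟩
  rw [convexHull_range_eq_exists_affineCombination]
  ext x
  simp only [Set.mem_image, Set.mem_ofPred_eq]
  constructor
  · rintro ⟨z, ⟨h0, h1⟩, rfl⟩
    have h1 : ∑ i, z i = 1 := by
      have := congrFun h1 0
      simpa [Matrix.mulVec, dotProduct] using this
    refine ⟨Finset.univ, z, fun i _ => ?_, h1, ?_⟩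
    · have := h0 i
      simpa [Matrix.neg_mulVec] using this
    · rw [Finset.affineCombination_eq_linear_combination _ _ _ h1]
      simp [Fintype.linearCombination_apply]
  · rintro ⟨s, w, h0, h1, rfl⟩
    refine ⟨fun i => if i ∈ s then w i else 0, ⟨fun i => ?_, ?_⟩, ?_⟩
    · simp only [Matrix.neg_mulVec, Matrix.one_mulVec, Pi.neg_apply, Pi.zero_apply]
      split_ifs with hi
      · simpa using h0 i hi
      · simp
    · ext j
      simpa [Matrix.mulVec, dotProduct] using h1
    · rw [Finset.affineCombination_eq_linear_combination _ _ _ h1]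
      simp [Fintype.linearCombination_apply, ite_smul]

/-- Normalised slack vectors of the vertices of a polytope. -/
theorem exists_slack {n r : ℕ} {ι : Type*} {A : Finset ι} {x : ι → Fin n → ℝ}
    (E : ExtendedFormulation (convexHull ℝ (x '' A)) r) :
    ∃ y : ι → Fin r → ℝ, (∀ v ∈ A, ∀ l, 0 ≤ y v l ∧ y v l ≤ 1) ∧
      (∀ l, (∀ v ∈ A, y v l = 0) ∨ ∃ v ∈ A, y v l = 1) ∧
      ∀ w : ι → ℝ, ∑ v ∈ A, w v = 1 → (∀ l, 0 ≤ ∑ v ∈ A, w v * y v l) →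
        ∑ v ∈ A, w v • x v ∈ convexHull ℝ (x '' A) := by
  classical
  have key : ∀ v ∈ A, ∃ z, ((∀ i, E.C.mulVec z i ≤ E.c i) ∧ E.D.mulVec z = E.d) ∧
      E.p z = x v := fun v hv => by
    have : x v ∈ convexHull ℝ (x '' A) := subset_convexHull ℝ _ ⟨v, hv, rfl⟩
    rw [← E.image_eq] at this
    exact this
  choose! q hq hqx using key
  let f : ι → Fin r → ℝ := fun v l => E.c l - E.C.mulVec (q v) l
  have hf : ∀ v ∈ A, ∀ l, 0 ≤ f v l := fun v hv l => sub_nonneg.2 ((hq v hv).1 l)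
  have hM : ∀ l, ∃ M : ℝ, 0 ≤ M ∧ (∀ v ∈ A, f v l ≤ M) ∧ (M = 0 ∨ ∃ v ∈ A, f v l = M) := by
    intro l
    rcases A.eq_empty_or_nonempty with rfl | hA
    · exact ⟨0, by simp⟩
    · obtain ⟨v, hv, hmax⟩ := A.exists_max_image (fun v => f v l) hA
      exact ⟨f v l, hf v hv l, hmax, .inr ⟨v, hv, rfl⟩⟩
  choose M hM0 hMle hMeq using hM
  -- If `M l = 0`, the slack vanishes on all of `A`, so division by zero is harmless.
  have hfy : ∀ v ∈ A, ∀ l, f v l = M l * (f v l / M l) := by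
    intro v hv l
    rcases eq_or_ne (M l) 0 with h | h
    · have := hMle l v hv
      have := hf v hv l
      simp only [h, zero_mul]
      linarith
    · field_simp
  refine ⟨fun v l => f v l / M l, fun v hv l => ⟨div_nonneg (hf v hv l) (hM0 l),
    div_le_one_of_le₀ (hMle l v hv) (hM0 l)⟩, fun l => ?_, fun w hw hpos => ?_⟩
  · rcases eq_or_ne (M l) 0 with h | h
    · exact .inl fun v _ => by simp [h]
    · obtain ⟨v, hv, hvM⟩ := (hMeq l).resolve_left h
      exact .inr ⟨v, hv, by simp [hvM, h]⟩
  · rw [← E.image_eq]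
    -- The weights may be negative: since they sum to one, equations persist and slacks combine
    -- linearly.
    refine ⟨∑ v ∈ A, w v • q v, ⟨fun l => ?_, ?_⟩, ?_⟩
    · have h1 : E.c l - E.C.mulVec (∑ v ∈ A, w v • q v) l = ∑ v ∈ A, w v * f v l := by
        simp only [f, mul_sub, Finset.sum_sub_distrib, ← Finset.sum_mul, hw, one_mul]
        simp [Matrix.mulVec_sum, Matrix.mulVec_smul]
      have h2 : ∑ v ∈ A, w v * f v l = M l * ∑ v ∈ A, w v * (f v l / M l) := by
        rw [Finset.mul_sum]
        refine Finset.sum_congr rfl fun v hv => ?_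
        conv_lhs => rw [hfy v hv l]
        ring
      have := mul_nonneg (hM0 l) (hpos l)
      linarith
    · rw [Matrix.mulVec_sum]
      simp only [Matrix.mulVec_smul]
      rw [Finset.sum_congr rfl fun v hv => by rw [(hq v hv).2], ← Finset.sum_smul, hw, one_smul]
    · rw [map_sum]
      exact Finset.sum_congr rfl fun v hv => by rw [map_smul, hqx v hv]

/-- A vertex of the cube has `ℓ¹`-distance at least one from the hull of the other vertices. -/
theorem one_le_sum_abs_sub {n : ℕ} {A : Set (Fin n → Bool)} {v : Fin n → Bool} (hv : v ∉ A)
    {q : Fin n → ℝ} (hq : q ∈ convexHull ℝ (cubePoint '' A)) :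
    1 ≤ ∑ i, |q i - cubePoint v i| := by
  -- This affine function equals the Hamming distance to `v` at cube vertices, hence is at least one
  -- on `A`.
  have hconv : Convex ℝ {q : Fin n → ℝ | 1 ≤ ∑ i, (1 - 2 * cubePoint v i) *
      (q i - cubePoint v i)} := by
    intro a ha b hb s t hs ht hst
    simp only [Set.mem_ofPred_eq] at *
    have : ∑ i, (1 - 2 * cubePoint v i) * ((s • a + t • b) i - cubePoint v i) =
        s * ∑ i, (1 - 2 * cubePoint v i) * (a i - cubePoint v i) +
        t * ∑ i, (1 - 2 * cubePoint v i) * (b i - cubePoint v i) := by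
      rw [Finset.mul_sum, Finset.mul_sum, ← Finset.sum_add_distrib]
      refine Finset.sum_congr rfl fun i _ => ?_
      obtain rfl : t = 1 - s := by linarith
      simp only [Pi.add_apply, Pi.smul_apply, smul_eq_mul]
      ring
    rw [this]
    nlinarith
  have hsub : cubePoint '' A ⊆ {q : Fin n → ℝ | 1 ≤ ∑ i, (1 - 2 * cubePoint v i) *
      (q i - cubePoint v i)} := by
    rintro _ ⟨u, hu, rfl⟩
    have huv : u ≠ v := fun h => hv (h ▸ hu)
    obtain ⟨i, hi⟩ := Function.ne_iff.1 huv
    have h0 : ∀ j, 0 ≤ (1 - 2 * cubePoint v j) * (cubePoint u j - cubePoint v j) := by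
      intro j
      cases hu : u j <;> cases hv : v j <;> norm_num [cubePoint, hu, hv]
    have h1 : 1 ≤ (1 - 2 * cubePoint v i) * (cubePoint u i - cubePoint v i) := by
      cases hu : u i <;> cases hv : v i <;> norm_num [cubePoint, hu, hv] <;> simp [hu, hv] at hi
    exact h1.trans (Finset.single_le_sum (fun j _ => h0 j) (Finset.mem_univ i))
  have h := convexHull_min hsub hconv hq
  refine le_trans h (Finset.sum_le_sum fun i _ => ?_)
  cases hv : v i
  · simpa [cubePoint, hv] using le_abs_self (q i)
  · simp only [cubePoint, hv]
    refine le_trans (le_of_eq ?_) (neg_le_abs _)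
    norm_num

/-! ### Integer approximation of a subspace -/

/-- The matrix of the orthogonal projection onto the complement of a subspace. -/
theorem exists_projection_matrix {J : Type*} [Fintype J] [DecidableEq J]
    (W : Submodule ℝ (J → ℝ)) :
    ∃ T : Matrix J J ℝ, (∀ i j, |T i j| ≤ 1) ∧ (∀ z ∈ W, T.mulVec z = 0) ∧
      ∀ z, z - T.mulVec z ∈ W := by
  let e := WithLp.linearEquiv 2 ℝ (J → ℝ)
  let W' : Submodule ℝ (EuclideanSpace ℝ J) := W.comap e.toLinearMap
  let P := W'ᗮ.starProjection
  let f : (J → ℝ) →ₗ[ℝ] (J → ℝ) := e.toLinearMap ∘ₗ P.toLinearMap ∘ₗ e.symm.toLinearMap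
  have hT : ∀ z, (LinearMap.toMatrix' f).mulVec z = e (P (e.symm z)) := fun z => by
    rw [LinearMap.toMatrix'_mulVec]; rfl
  refine ⟨LinearMap.toMatrix' f, fun i j => ?_, fun z hz => ?_, fun z => ?_⟩
  · have h1 : LinearMap.toMatrix' f i j = P (EuclideanSpace.single j 1) i := by
      rw [LinearMap.toMatrix'_apply]
      rfl
    rw [h1, ← Real.norm_eq_abs]
    refine (PiLp.norm_apply_le _ i).trans ((W'ᗮ.norm_starProjection_apply_le _).trans ?_)
    simp
  · rw [hT]
    have : e.symm z ∈ W' := by simpa [W'] using hz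
    have : P (e.symm z) = 0 := by
      rw [Submodule.starProjection_apply_eq_zero_iff]
      exact W'.le_orthogonal_orthogonal this
    simp [this]
  · rw [hT]
    have : e.symm z - P (e.symm z) ∈ W' := by
      have := W'ᗮ.sub_starProjection_mem_orthogonal (e.symm z)
      rwa [Submodule.orthogonal_orthogonal] at this
    simpa [W'] using this

/-- A subspace can be described up to a small error by an integer matrix with small entries. -/
theorem exists_integer_matrix {J : Type*} [Fintype J] [DecidableEq J]
    (W : Submodule ℝ (J → ℝ)) (K : ℕ) :
    ∃ M : J → J → Finset.Icc (-(K : ℤ)) K, ∀ z : J → ℝ, (∀ j, |z j| ≤ 1) →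
      (z ∈ W → ∀ i, |∑ j, ((M i j : ℤ) : ℝ) * z j| ≤ Fintype.card J) ∧
      ((∀ i, |∑ j, ((M i j : ℤ) : ℝ) * z j| ≤ Fintype.card J) →
        ∃ z' ∈ W, ∀ i, K * |z' i - z i| ≤ 2 * Fintype.card J) := by
  obtain ⟨T, hT1, hT0, hTW⟩ := exists_projection_matrix W
  have hmem : ∀ i j, ⌊K * T i j⌋ ∈ Finset.Icc (-(K : ℤ)) K := by
    intro i j
    have h := abs_le.1 (hT1 i j)
    have hK : (0 : ℝ) ≤ K := K.cast_nonneg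
    rw [Finset.mem_Icc, Int.le_floor]
    refine ⟨by push_cast; nlinarith, ?_⟩
    have : ((⌊K * T i j⌋ : ℤ) : ℝ) ≤ (K : ℤ) := (Int.floor_le _).trans (by push_cast; nlinarith)
    exact_mod_cast this
  refine ⟨fun i j => ⟨_, hmem i j⟩, fun z hz => ?_⟩
  have herr : ∀ i, |K * T.mulVec z i - ∑ j, ((⌊K * T i j⌋ : ℤ) : ℝ) * z j| ≤
      Fintype.card J := by
    intro i
    have h1 : K * T.mulVec z i - ∑ j, ((⌊K * T i j⌋ : ℤ) : ℝ) * z j =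
        ∑ j, Int.fract (K * T i j) * z j := by
      simp only [Matrix.mulVec, dotProduct, Finset.mul_sum, ← Finset.sum_sub_distrib]
      refine Finset.sum_congr rfl fun j _ => ?_
      rw [Int.fract]
      ring
    rw [h1]
    refine (Finset.abs_sum_le_sum_abs _ _).trans ?_
    refine (Finset.sum_le_sum (g := fun _ => (1 : ℝ)) fun j _ => ?_).trans (by simp)
    rw [abs_mul, abs_of_nonneg (Int.fract_nonneg _)]
    exact mul_le_one₀ (Int.fract_lt_one _).le (abs_nonneg _) (hz j)
  refine ⟨fun hzW i => ?_, fun H => ⟨z - T.mulVec z, hTW z, fun i => ?_⟩⟩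
  · simpa [hT0 z hzW] using herr i
  · have h1 : K * |(z - T.mulVec z) i - z i| = |K * T.mulVec z i| := by
      rw [Pi.sub_apply, abs_mul, Nat.abs_cast, sub_sub_cancel_left, abs_neg]
    have h2 := abs_sub_abs_le_abs_sub (K * T.mulVec z i) (∑ j, ((⌊K * T i j⌋ : ℤ) : ℝ) * z j)
    have h3 := herr i
    have h4 := H i
    rw [h1]
    simp only at h4
    linarith

/-! ### Decoding the vertex set -/

/-- A vertex of the cube satisfies the system of approximate equations given by `M`, for some
vector of slacks in the unit cube. -/
def Accepts {n r : ℕ} {K : ℤ}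
    (M : Fin n ⊕ (Fin r ⊕ Unit) → Fin n ⊕ (Fin r ⊕ Unit) → Finset.Icc (-K) K)
    (v : Fin n → Bool) : Prop :=
  ∃ y : Fin r → ℝ, (∀ l, 0 ≤ y l ∧ y l ≤ 1) ∧
    ∀ i, |∑ j, ((M i j : ℤ) : ℝ) * homogenize (cubePoint v) y j| ≤ (n + r + 1 : ℕ)

theorem abs_homogenize_cubePoint_le_one {n r : ℕ} (v : Fin n → Bool) {y : Fin r → ℝ}
    (hy : ∀ l, 0 ≤ y l ∧ y l ≤ 1) (j) : |homogenize (cubePoint v) y j| ≤ 1 := by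
  rcases j with i | l | u
  · cases h : v i <;> simp [homogenize, cubePoint, h]
  · simpa [homogenize, abs_le] using ⟨by linarith [(hy l).1], (hy l).2⟩
  · simp [homogenize]

theorem abs_sum_cubePoint_le_card {n : ℕ} (A : Finset (Fin n → Bool)) (i : Fin n) :
    |∑ v ∈ A, cubePoint v i| ≤ 2 ^ n := by
  refine (Finset.abs_sum_le_sum_abs _ _).trans ?_
  refine (Finset.sum_le_sum (g := fun _ => (1 : ℝ)) fun v _ => ?_).trans ?_
  · cases h : v i <;> simp [cubePoint, h]
  · have := A.card_le_univ
    simp at this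
    simpa using (by exact_mod_cast this : (A.card : ℝ) ≤ 2 ^ n)

/-- A point close to the span of the vectors `(x, y, 1)` over the vertices `x` of a polytope has
its first component in the polytope, if it is a vertex of the cube and `y ≥ 0`. -/
theorem mem_of_close {n r : ℕ} {A : Finset (Fin n → Bool)} {y : (Fin n → Bool) → Fin r → ℝ}
    (hy : ∀ v ∈ A, ∀ l, 0 ≤ y v l)
    (hy' : ∀ l, (∀ v ∈ A, y v l = 0) ∨ ∃ v ∈ A, y v l = 1)
    (hconv : ∀ w : (Fin n → Bool) → ℝ, ∑ v ∈ A, w v = 1 → (∀ l, 0 ≤ ∑ v ∈ A, w v * y v l) →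
      ∑ v ∈ A, w v • cubePoint v ∈ convexHull ℝ (cubePoint '' (A : Set (Fin n → Bool))))
    {u : Fin n → Bool} {s : Fin r → ℝ} (hs : ∀ l, 0 ≤ s l) {δ : ℝ} (hδ0 : 0 ≤ δ)
    (hδ : (2 * n + 1) * (δ * (1 + 2 ^ n)) < 1) {μ : (Fin n → Bool) → ℝ}
    (hμ : ∀ j, |∑ v ∈ A, μ v * homogenize (cubePoint v) (y v) j -
      homogenize (cubePoint u) s j| ≤ δ) : u ∈ A := by
  by_contra hu
  set θ := δ * (1 + 2 ^ n) with hθ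
  have hθ0 : 0 ≤ θ := by positivity
  -- Raising every weight by `δ` adds at least `δ` to each slack coordinate that attains 1, which
  -- absorbs the error there. Elsewhere it costs at most `2 ^ n * δ`, whence `θ`.
  set t := ∑ v ∈ A, (μ v + δ) with ht
  have hcard : (A.card : ℝ) ≤ 2 ^ n := by
    have := A.card_le_univ
    simp at this
    exact_mod_cast this
  have ht1 : |t - 1| ≤ θ := by
    have h := abs_le.1 (hμ (.inr (.inr ())))
    simp only [homogenize, Sum.elim_inr, mul_one] at h
    rw [ht, Finset.sum_add_distrib, Finset.sum_const, nsmul_eq_mul, abs_le]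
    have : (A.card : ℝ) * δ ≤ 2 ^ n * δ := by gcongr
    have : 0 ≤ (A.card : ℝ) * δ := by positivity
    constructor <;> rw [hθ] <;> nlinarith
  have hx : ∀ i, |∑ v ∈ A, (μ v + δ) * cubePoint v i - cubePoint u i| ≤ θ := by
    intro i
    have h := abs_le.1 (hμ (.inl i))
    simp only [homogenize, Sum.elim_inl] at h
    have h2 := abs_le.1 (abs_sum_cubePoint_le_card A i)
    simp only [add_mul, Finset.sum_add_distrib, ← Finset.mul_sum]
    rw [abs_le, hθ]
    constructor <;> nlinarith
  have hpos : 0 < t := by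
    have := abs_le.1 ht1
    have : (0 : ℝ) ≤ 2 * n * θ := by positivity
    nlinarith
  have hmem := hconv (fun v => t⁻¹ * (μ v + δ)) (by
    rw [← Finset.mul_sum, ← ht, inv_mul_cancel₀ hpos.ne']) (fun l => by
    simp only [mul_assoc, ← Finset.mul_sum]
    refine mul_nonneg (inv_nonneg.2 hpos.le) ?_
    rcases hy' l with h | ⟨v, hv, hv1⟩
    · exact (Finset.sum_eq_zero fun v hv => by rw [h v hv, mul_zero]).ge
    · have h1 := abs_le.1 (hμ (.inr (.inl l)))
      simp only [homogenize, Sum.elim_inr, Sum.elim_inl] at h1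
      have h2 : 1 ≤ ∑ v ∈ A, y v l :=
        hv1.ge.trans (Finset.single_le_sum (f := fun v => y v l) (fun v hv => hy v hv l) hv)
      have h3 := hs l
      simp only [add_mul, Finset.sum_add_distrib, ← Finset.mul_sum]
      nlinarith)
  have hdist := one_le_sum_abs_sub (by simpa using hu) hmem
  have hle : ∀ i, |(∑ v ∈ A, (t⁻¹ * (μ v + δ)) • cubePoint v) i - cubePoint u i| ≤
      t⁻¹ * (2 * θ) := by
    intro i
    have h1 : (∑ v ∈ A, (t⁻¹ * (μ v + δ)) • cubePoint v) i - cubePoint u i =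
        t⁻¹ * ((∑ v ∈ A, (μ v + δ) * cubePoint v i - cubePoint u i) -
          (t - 1) * cubePoint u i) := by
      simp only [Finset.sum_apply, Pi.smul_apply, smul_eq_mul, mul_assoc, ← Finset.mul_sum]
      field_simp
      ring
    rw [h1, abs_mul, abs_of_pos (inv_pos.2 hpos)]
    refine mul_le_mul_of_nonneg_left ?_ (inv_nonneg.2 hpos.le)
    refine (abs_sub _ _).trans ?_
    have h2 : |(t - 1) * cubePoint u i| ≤ |t - 1| := by
      cases h : u i <;> simp [cubePoint, h]
    linarith [hx i]
  have h := hdist.trans (Finset.sum_le_sum fun i _ => hle i)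
  rw [Finset.sum_const, Finset.card_univ, Fintype.card_fin, nsmul_eq_mul] at h
  -- Together with `t ≥ 1 - θ` this contradicts `(2 * n + 1) * θ < 1`.
  have h' : t ≤ n * (2 * θ) := by
    have := mul_le_mul_of_nonneg_left h hpos.le
    field_simp at this
    linarith
  have := abs_le.1 ht1
  nlinarith

/-- The vertices of a `0/1`-polytope with a small extended formulation are exactly those accepted
by some integer matrix with small entries. -/
theorem exists_accepts_iff {n r : ℕ} (A : Finset (Fin n → Bool))
    (E : ExtendedFormulation (convexHull ℝ (cubePoint '' (A : Set (Fin n → Bool)))) r) {K : ℕ}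
    (hK : (2 * n + 1) * (2 * (n + r + 1) * (1 + 2 ^ n)) < K) :
    ∃ M : Fin n ⊕ (Fin r ⊕ Unit) → Fin n ⊕ (Fin r ⊕ Unit) → Finset.Icc (-(K : ℤ)) K,
      ∀ u, u ∈ A ↔ Accepts M u := by
  obtain ⟨y, hy01, hy', hconv⟩ := E.exists_slack
  let h : (Fin n → Bool) → Fin n ⊕ (Fin r ⊕ Unit) → ℝ := fun v => homogenize (cubePoint v) (y v)
  have hJ : Fintype.card (Fin n ⊕ (Fin r ⊕ Unit)) = n + r + 1 := by simp [add_assoc]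
  obtain ⟨M, hM⟩ := exists_integer_matrix (Submodule.span ℝ (h '' (A : Set (Fin n → Bool)))) K
  rw [hJ] at hM
  refine ⟨M, fun u => ⟨fun hu => ⟨y u, hy01 u hu, ?_⟩, ?_⟩⟩
  · exact (hM _ (abs_homogenize_cubePoint_le_one u (hy01 u hu))).1
      (Submodule.subset_span ⟨u, hu, rfl⟩)
  · rintro ⟨s, hs, hacc⟩
    obtain ⟨z, hz, hclose⟩ := (hM _ (abs_homogenize_cubePoint_le_one u hs)).2 hacc
    obtain ⟨μ, rfl⟩ := (Submodule.mem_span_image_finset_iff_exists_fun' ℝ).1 hz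
    have hK' : (2 * n + 1) * (2 * (n + r + 1) * (1 + 2 ^ n)) < (K : ℝ) := by exact_mod_cast hK
    have hK0 : (0 : ℝ) < K := lt_of_le_of_lt (by positivity) hK'
    refine mem_of_close (fun v hv l => (hy01 v hv l).1) hy' hconv (fun l => (hs l).1)
      (δ := 2 * (n + r + 1) / K) (by positivity) ?_ (μ := μ) fun j => ?_
    · have : (2 * n + 1) * (2 * (n + r + 1) / K * (1 + 2 ^ n)) =
        (2 * n + 1) * (2 * (n + r + 1) * (1 + 2 ^ n)) / (K : ℝ) := by ring
      rw [this, div_lt_one hK0]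
      exact hK'
    · rw [le_div_iff₀' hK0]
      simpa [h] using hclose j

/-! ### Counting -/

/-- If all `0/1`-polytopes in `ℝⁿ` have extended formulations of size `r`, then `r` is large. -/
theorem two_pow_le_of_forall {n r : ℕ} (hn : 1 ≤ n) (hr : r ≤ 2 ^ n)
    (H : ∀ A : Finset (Fin n → Bool), Nonempty
      (ExtendedFormulation (convexHull ℝ (cubePoint '' (A : Set (Fin n → Bool)))) r)) :
    2 ^ n ≤ 9 * n * (n + r + 1) ^ 2 := by
  classical
  have hn1 : n + 1 ≤ 2 ^ n := Nat.lt_two_pow_self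
  set K := 2 ^ (3 * n + 4) with hKdef
  have hK : (2 * n + 1) * (2 * (n + r + 1) * (1 + 2 ^ n)) < K := by
    have hK2 : K = (2 * 2 ^ n) * (2 * (2 ^ n + 2 ^ n) * (2 ^ n + 2 ^ n)) := by
      rw [hKdef]; ring
    rw [hK2]
    have h1 : 1 ≤ 2 ^ n := Nat.one_le_two_pow
    refine Nat.mul_lt_mul_of_lt_of_le (by omega) ?_ (by positivity)
    exact Nat.mul_le_mul (Nat.mul_le_mul_left _ (by omega)) (by omega)
  choose M hM using fun A => exists_accepts_iff A (H A).some hK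
  have hinj : Function.Injective M := fun A B hAB => by
    ext u
    rw [hM, hM, hAB]
  have hcard := Fintype.card_le_of_injective M hinj
  have hJ : Fintype.card (Fin n ⊕ (Fin r ⊕ Unit)) = n + r + 1 := by simp [add_assoc]
  rw [Fintype.card_finset, Fintype.card_fun, Fintype.card_fun, Fintype.card_fun,
    Fintype.card_fin, Fintype.card_bool, Fintype.card_coe, Int.card_Icc, hJ, ← pow_mul] at hcard
  -- An entry takes `2 * K + 1 ≤ 2 ^ (3 * n + 6)` values; `n ≥ 1` turns this into `2 ^ (9 * n)`.
  have hsize : ((K : ℤ) + 1 - -(K : ℤ)).toNat ≤ 2 ^ (9 * n) := by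
    have h1 : ((K : ℤ) + 1 - -(K : ℤ)).toNat = 2 * K + 1 := by omega
    have h2 : 2 ^ (3 * n + 6) ≤ 2 ^ (9 * n) := Nat.pow_le_pow_right (by norm_num) (by omega)
    have h3 : 2 ^ (3 * n + 6) = 4 * K := by rw [hKdef]; ring
    have h4 : 1 ≤ K := Nat.one_le_two_pow
    omega
  have := hcard.trans (Nat.pow_le_pow_left hsize _)
  rw [← pow_mul] at this
  refine ((Nat.pow_le_pow_iff_right (by norm_num)).1 this).trans (le_of_eq ?_)
  ring

/-- A segment is not the projection of an affine subspace. -/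
theorem exists_one_le_extensionComplexity {n : ℕ} (hn : 1 ≤ n) :
    ∃ A : Finset (Fin n → Bool), 1 ≤ extensionComplexity
      (convexHull ℝ (cubePoint '' (A : Set (Fin n → Bool)))) := by
  classical
  refine ⟨{fun _ => false, fun _ => true}, ?_⟩
  rw [Nat.one_le_iff_ne_zero]
  intro h0
  have hne := nonempty_of_finite (Set.Finite.image cubePoint
    (({fun _ => false, fun _ => true} : Finset (Fin n → Bool)).finite_toSet))
  have hmem := Nat.sInf_mem (s := {k : ℕ | Nonempty (ExtendedFormulation _ k)}) hne
  unfold extensionComplexity at h0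
  rw [h0] at hmem
  obtain ⟨E⟩ := hmem
  obtain ⟨y, -, -, hconv⟩ := E.exists_slack
  have hft : (fun _ => false : Fin n → Bool) ≠ fun _ => true :=
    fun h => by simpa using congrFun h ⟨0, hn⟩
  -- Without inequalities every affine combination is allowed; weights 2 and -1 leave the segment.
  have h := hconv (fun v => if v = fun _ => true then 2 else -1)
    (by rw [Finset.sum_pair hft]; simp [hft]; norm_num) (fun l => l.elim0)
  rw [Finset.sum_pair hft] at h
  have hsub : cubePoint '' ((({fun _ => false, fun _ => true} : Finset (Fin n → Bool))) :
      Set (Fin n → Bool)) ⊆ {x | x ⟨0, hn⟩ ≤ 1} := by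
    rintro _ ⟨v, -, rfl⟩
    cases hv : v ⟨0, hn⟩ <;> simp [cubePoint, hv]
  have hle := convexHull_min hsub (convex_halfSpace_le
    (LinearMap.proj (R := ℝ) (φ := fun _ : Fin n => ℝ) ⟨0, hn⟩).isLinear 1) h
  norm_num [hft, cubePoint] at hle

end ExtendedFormulation

open ExtendedFormulation

theorem mainTheorem1 :
    ∃ c : ℝ, 0 < c ∧ ∀ n : ℕ, 1 ≤ n →
      ∃ X : Set (Fin n → ℝ), (∀ x ∈ X, ∀ i, x i = 0 ∨ x i = 1) ∧
        c * ((2 : ℝ) ^ ((n : ℝ) / 2) / Real.sqrt ((n : ℝ) * Real.logb 2 (2 * (n : ℝ)))) ≤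
          (extensionComplexity (convexHull ℝ X) : ℝ) := by
  -- The constant makes the bound at most 1 for `n < 40`, where a segment suffices.
  refine ⟨1 / 2 ^ 20, by positivity, fun n hn => ?_⟩
  suffices ∃ A : Finset (Fin n → Bool), 1 / 2 ^ 20 * ((2 : ℝ) ^ ((n : ℝ) / 2) /
      Real.sqrt ((n : ℝ) * Real.logb 2 (2 * (n : ℝ)))) ≤
      (extensionComplexity (convexHull ℝ (cubePoint '' (A : Set (Fin n → Bool)))) : ℝ) by
    obtain ⟨A, hA⟩ := this
    refine ⟨_, ?_, hA⟩
    rintro _ ⟨v, -, rfl⟩ i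
    cases h : v i <;> simp [cubePoint, h]
  have hnR : (1 : ℝ) ≤ n := by exact_mod_cast hn
  have hlog : 1 ≤ Real.logb 2 (2 * (n : ℝ)) := by
    rw [Real.le_logb_iff_rpow_le (by norm_num) (by positivity)]
    norm_num
    linarith
  -- The logarithm is at least one and is discarded; counting gives the bound without it.
  have hsqrt : Real.sqrt n ≤ Real.sqrt ((n : ℝ) * Real.logb 2 (2 * (n : ℝ))) :=
    Real.sqrt_le_sqrt (by nlinarith)
  have hpow2 : ((2 : ℝ) ^ ((n : ℝ) / 2)) ^ 2 = 2 ^ n := by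
    rw [← Real.rpow_natCast, ← Real.rpow_mul (by norm_num), ← Real.rpow_natCast]
    congr 1
    push_cast
    ring
  set T := 1 / 2 ^ 20 * ((2 : ℝ) ^ ((n : ℝ) / 2) /
      Real.sqrt ((n : ℝ) * Real.logb 2 (2 * (n : ℝ)))) with hT
  have hT0 : 0 ≤ T := by positivity
  have hT1 : T ≤ 1 / 2 ^ 20 * ((2 : ℝ) ^ ((n : ℝ) / 2) / Real.sqrt n) := by
    rw [hT]
    gcongr
  have hTsq : n * T ^ 2 ≤ 2 ^ n / 2 ^ 40 := by
    have h1 : T ^ 2 ≤ (1 / 2 ^ 20 * ((2 : ℝ) ^ ((n : ℝ) / 2) / Real.sqrt n)) ^ 2 := by gcongr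
    have h2 : (1 / 2 ^ 20 * ((2 : ℝ) ^ ((n : ℝ) / 2) / Real.sqrt n)) ^ 2 =
        (1 / 2 ^ 20) ^ 2 * (2 ^ n / n) := by
      rw [mul_pow, div_pow _ (Real.sqrt n), hpow2, Real.sq_sqrt (by positivity)]
    rw [h2] at h1
    calc n * T ^ 2 ≤ n * ((1 / 2 ^ 20) ^ 2 * (2 ^ n / n)) := by gcongr
      _ = 2 ^ n / 2 ^ 40 := by field_simp
  rcases lt_or_ge n 40 with hsmall | hlarge
  · obtain ⟨A, hA⟩ := exists_one_le_extensionComplexity hn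
    refine ⟨A, le_trans ?_ (by exact_mod_cast hA : (1 : ℝ) ≤ _)⟩
    have h2 : (2 : ℝ) ^ n ≤ 2 ^ 40 := pow_le_pow_right₀ (by norm_num) hsmall.le
    have h3 : (2 : ℝ) ^ n / 2 ^ 40 ≤ 1 := (div_le_one (by positivity)).2 h2
    nlinarith
  · by_contra! hcon
    have hfloor : ∀ A : Finset (Fin n → Bool), Nonempty (ExtendedFormulation
        (convexHull ℝ (cubePoint '' (A : Set (Fin n → Bool)))) ⌊T⌋₊) := fun A => by
      have hmem := Nat.sInf_mem (s := {k : ℕ | Nonempty (ExtendedFormulation _ k)})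
        (nonempty_of_finite (A.finite_toSet.image cubePoint))
      obtain ⟨E⟩ := hmem
      exact nonempty_mono (Nat.le_floor (hcon A).le) E
    have hfT : (⌊T⌋₊ : ℝ) ≤ T := Nat.floor_le hT0
    have hpow1 : (1 : ℝ) ≤ 2 ^ n := one_le_pow₀ (by norm_num)
    have hr : ⌊T⌋₊ ≤ 2 ^ n := by
      have h1 : T ^ 2 ≤ ((2 : ℝ) ^ n) ^ 2 := by
        have h4 : (2 : ℝ) ^ n / 2 ^ 40 ≤ 2 ^ n := div_le_self (by positivity) (by norm_num)
        nlinarith [sq_nonneg T]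
      have h2 : T ≤ 2 ^ n := (sq_le_sq₀ hT0 (by positivity)).1 h1
      exact_mod_cast hfT.trans h2
    have hcount := two_pow_le_of_forall hn hr hfloor
    have hcountR : (2 : ℝ) ^ n ≤ 9 * n * (n + ⌊T⌋₊ + 1) ^ 2 := by exact_mod_cast hcount
    -- The terms `18 * n * (n + 1) ^ 2` and `18 * n * T ^ 2` of the final estimate are then at most
    -- `2 ^ n / 8` and `2 ^ n / 2`.
    have hgrow : ∀ m : ℕ, 40 ≤ m → 144 * m * (m + 1) ^ 2 ≤ 2 ^ m := by
      intro m hm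
      induction m, hm using Nat.le_induction with
      | base => norm_num
      | succ k hk ih =>
        have h1 : (k + 2) ^ 2 ≤ 2 * (k * (k + 1)) := by nlinarith
        calc 144 * (k + 1) * (k + 1 + 1) ^ 2 ≤ 144 * (k + 1) * (2 * (k * (k + 1))) := by gcongr
          _ = 144 * k * (k + 1) ^ 2 * 2 := by ring
          _ ≤ 2 ^ k * 2 := by gcongr
          _ = 2 ^ (k + 1) := (pow_succ _ _).symm
    have hgrowR : 144 * (n : ℝ) * (n + 1) ^ 2 ≤ 2 ^ n := by exact_mod_cast hgrow n hlarge
    have h1 : ((n : ℝ) + ⌊T⌋₊ + 1) ^ 2 ≤ 2 * (n + 1) ^ 2 + 2 * T ^ 2 := by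
      have : (⌊T⌋₊ : ℝ) ^ 2 ≤ T ^ 2 := by gcongr
      nlinarith [sq_nonneg ((n : ℝ) + 1 - ⌊T⌋₊)]
    have h2 : 9 * (n : ℝ) * (n + ⌊T⌋₊ + 1) ^ 2 ≤
        9 * n * (2 * (n + 1) ^ 2 + 2 * T ^ 2) := by gcongr
    have h3 : (2 : ℝ) ^ n / 2 ^ 40 ≤ 2 ^ n / 36 := by
      gcongr
      norm_num
    nlinarith
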